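/- Let $r\ge 2$ be an even integer, $m\ge 3$ an odd integer, $n=2^m-1$, and let $t\neq 1$ be an odd integer with $m\equiv t \pmod r$. Let $S\subset\mathbb{Z}_r=\mathbb{Z}/r\mathbb{Z}$ have $|S|=r/2$, let $S'=\mathbb{Z}_r\setminus S$, and suppose that $S'=\{t-i : i\in S\}$. Let $\alpha$ be a generator of $\mathbb{F}_{2^m}^*$. For $R\in\{S,S'\}$ let $T_{[r,m,R]}$ be the set of all $1\le j\le n-1$ such that the number of ones in the binary expansion of $j$, reduced modulo $r$, lies in $R$, and let $\mathcal{C}_{[r,m,R]}$ be the binary cyclic code of length $n$ with generator polynomial $\prod_{j\in T_{[r,m,R]}}(x-\alpha^j)\in\mathbb{F}_2[x]$. The defining set of a cyclic code of length $n$ with generator polynomial $g$ is $\{i\in\mathbb{Z}_n: g(\alpha^i)=0\}$. Two binary cyclic codes of length $n$ form a pair of odd-like (even-like) duadic codes if their defining sets are $S_1,S_2$ (respectively $\{0\}\cup S_1,\{0\}\cup S_2$), where $S_1,S_2$ are unions of $2$-cyclotomic cosets modulo $n$ that partition $\mathbb{Z}_n\setminus\{0\}$ and some unit $\mu$ of $\mathbb{Z}_n$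 satisfies $S_1\mu=S_2$ and $S_2\mu=S_1$. Suppose that $S$ contains (the residues modulo $r$ of) $\frac{t-1}{2}$, $\frac{t+r-1}{2}$ and $1$, or that $S$ contains $\frac{t+1}{2}$, $\frac{t+r+1}{2}$ and $t-1$. Then: (1) $\mathcal{C}_{[r,m,S]}$ and $\mathcal{C}_{[r,m,S']}$ form a pair of odd-like duadic codes, each with parameters $[2^m-1,\,2^{m-1},\,d\ge 2^{\frac{m-1}{2}}+1]$. (2) The dual codes $\mathcal{C}_{[r,m,S]}^{\perp}$ and $\mathcal{C}_{[r,m,S']}^{\perp}$ form a pair of even-like duadic codes, each with parameters $[2^m-1,\,2^{m-1}-1,\,d^{\perp}\ge 2^{\frac{m-1}{2}}+2]$. (3) The extended codes $\overline{\mathcal{C}_{[r,m,S]}}$ and $\overline{\mathcal{C}_{[r,m,S']}}$, obtained by appending an overall parity check coordinate, are self-dual and doubly-even (all weights are divisible by $4$) and have parameters $[2^m,\,2^{m-1},\,\overline{d}\,]$, where $\overline{d}\ge 2^{\frac{m-1}{2}}+4$ if $m\ge 5$, and $\overline{d}\ge 2^{\frac{m-1}{2}}+2=4$ if $m=3$.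 -/

import Mathlib

open Polynomial

/-! ### Binary linear codes: minimum distance, parameters, dual and extended codes -/

/-- A binary linear code of length `n`. -/
abbrev BinaryCode (n : ℕ) := Submodule (ZMod 2) (Fin n → ZMod 2)

namespace BinaryCode

/-- The minimum Hamming distance between two different codewords. -/
noncomputable def minDist {n : ℕ} (C : BinaryCode n) : ℕ :=
  sInf {d | ∃ x ∈ C, ∃ y ∈ C, x ≠ y ∧ hammingDist x y = d}

/-- `C` is an `[N, k, d ≥ δ]` code: its length is `N`, its dimension is `k`, it has two different
codewords, and its minimum distance is at least `δ`. -/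
def HasParameters {n : ℕ} (C : BinaryCode n) (N k δ : ℕ) : Prop :=
  n = N ∧ Module.finrank (ZMod 2) C = k ∧ C ≠ ⊥ ∧ δ ≤ C.minDist

/-- The dual code, with respect to the standard inner product. -/
def dual {n : ℕ} (C : BinaryCode n) : BinaryCode n where
  carrier := {x | ∀ c ∈ C, ∑ i, x i * c i = 0}
  zero_mem' := by intro c _; simp
  add_mem' := by
    intro x y hx hy c hc
    have h := congrArg₂ (· + ·) (hx c hc) (hy c hc)
    simpa [add_mul, Finset.sum_add_distrib] using h
  smul_mem' := by
    intro a x hx c hc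
    have h := congrArg (a * ·) (hx c hc)
    simpa [Finset.mul_sum, mul_assoc] using h

/-- The extended code: a codeword of `C` followed by one overall parity check coordinate. -/
def extended {n : ℕ} (C : BinaryCode n) : BinaryCode (n + 1) where
  carrier := {c | (fun i : Fin n => c i.castSucc) ∈ C ∧ ∑ i, c i = 0}
  zero_mem' := by
    refine ⟨?_, by simp⟩
    exact C.zero_mem
  add_mem' := by
    rintro x y ⟨hx, hx0⟩ ⟨hy, hy0⟩
    refine ⟨C.add_mem hx hy, ?_⟩
    have h := congrArg₂ (· + ·) hx0 hy0
    simpa [Finset.sum_add_distrib] using h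
  smul_mem' := by
    rintro a x ⟨hx, hx0⟩
    refine ⟨C.smul_mem a hx, ?_⟩
    have h := congrArg (a * ·) hx0
    simpa [Finset.mul_sum] using h

/-- `C` equals its dual. -/
def IsSelfDual {n : ℕ} (C : BinaryCode n) : Prop := C.dual = C

/-- All weights are divisible by four. -/
def IsDoublyEven {n : ℕ} (C : BinaryCode n) : Prop := ∀ c ∈ C, 4 ∣ hammingNorm c

/-! ### Cyclic codes, defining sets and duadic codes -/

/-- The polynomial `c₀ + c₁ X + ⋯ + cₙ₋₁ X ^ (n - 1)` of a word. -/
noncomputable def wordPoly {n : ℕ} (c : Fin n → ZMod 2) : (ZMod 2)[X] :=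
  ∑ i, C (c i) * X ^ (i : ℕ)

/-- The binary code of length `n` whose codewords are the words with polynomial divisible by `g`.
For `g ∣ X ^ n - 1` it is the cyclic code of length `n` with generator polynomial `g`. -/
noncomputable def cyclic (n : ℕ) (g : (ZMod 2)[X]) : BinaryCode n where
  carrier := {c | g ∣ wordPoly c}
  zero_mem' := by simp [wordPoly]
  add_mem' := by
    intro x y hx hy
    have h := dvd_add hx hy
    simpa [wordPoly, add_mul, Finset.sum_add_distrib] using h
  smul_mem' := by
    intro a x hx
    have h := Dvd.dvd.mul_left hx (C a)
    simpa [wordPoly, Finset.mul_sum, mul_assoc] using h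

/-- `D` is a cyclic code of length `n` and `T` is its defining set relative to `α`, that is, the
set of the exponents modulo `n` of the powers of `α` at which the generator polynomial vanishes. -/
def HasDefiningSet {F : Type*} [Field F] [Algebra (ZMod 2) F] (α : F) {n : ℕ}
    (D : BinaryCode n) (T : Set (ZMod n)) : Prop :=
  ∃ g : (ZMod 2)[X], g ∣ X ^ n - 1 ∧ D = cyclic n g ∧ T = {i : ZMod n | aeval (α ^ i.val) g = 0}

/-- The `2`-cyclotomic coset of `s` modulo `n`. -/
def cyclotomicCoset {n : ℕ} (s : ZMod n) : Set (ZMod n) := {x | ∃ k : ℕ, x = s * 2 ^ k}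

/-- `(S₁, S₂, μ)` is a splitting of `ℤ / n`: both sets are unions of `2`-cyclotomic cosets, they
partition the nonzero residues, and the unit `μ` interchanges them. -/
def IsSplitting {n : ℕ} (S₁ S₂ : Set (ZMod n)) (μ : (ZMod n)ˣ) : Prop :=
  (∀ s ∈ S₁, cyclotomicCoset s ⊆ S₁) ∧ (∀ s ∈ S₂, cyclotomicCoset s ⊆ S₂) ∧
  S₁ ∪ S₂ = {0}ᶜ ∧ S₁ ∩ S₂ = ∅ ∧
  (fun s => s * (μ : ZMod n)) '' S₁ = S₂ ∧ (fun s => s * (μ : ZMod n)) '' S₂ = S₁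

/-- `D₁`, `D₂` form a pair of odd-like duadic codes (defining sets taken relative to `α`). -/
def IsOddLikeDuadicPair {F : Type*} [Field F] [Algebra (ZMod 2) F] (α : F) {n : ℕ}
    (D₁ D₂ : BinaryCode n) : Prop :=
  ∃ (S₁ S₂ : Set (ZMod n)) (μ : (ZMod n)ˣ), IsSplitting S₁ S₂ μ ∧
    HasDefiningSet α D₁ S₁ ∧ HasDefiningSet α D₂ S₂

/-- `D₁`, `D₂` form a pair of even-like duadic codes (defining sets taken relative to `α`). -/
def IsEvenLikeDuadicPair {F : Type*} [Field F] [Algebra (ZMod 2) F] (α : F) {n : ℕ}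
    (D₁ D₂ : BinaryCode n) : Prop :=
  ∃ (S₁ S₂ : Set (ZMod n)) (μ : (ZMod n)ˣ), IsSplitting S₁ S₂ μ ∧
    HasDefiningSet α D₁ ({0} ∪ S₁) ∧ HasDefiningSet α D₂ ({0} ∪ S₂)

/-! ### The codes defined by the binary weights of the exponents -/

/-- The number of ones in the binary expansion of `j`. -/
def binaryWeight (j : ℕ) : ℕ := (Nat.digits 2 j).sum

/-- The exponents `1 ≤ j ≤ 2 ^ m - 2` whose binary weight modulo `r` lies in `S`. -/
def weightSet (r m : ℕ) (S : Finset (ZMod r)) : Finset ℕ :=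
  (Finset.Icc 1 (2 ^ m - 2)).filter fun j => (binaryWeight j : ZMod r) ∈ S

/-- The product of the linear factors `X - α ^ j`, over the exponents `j` in `weightSet r m S`. -/
noncomputable def weightProd {F : Type*} [Field F] (r m : ℕ) (S : Finset (ZMod r)) (α : F) :
    F[X] :=
  ∏ j ∈ weightSet r m S, (X - C (α ^ j))

/-- The generator polynomial: the binary polynomial whose image over `F` is `weightProd r m S α`
(it exists, by `map_weightPoly` below). -/
noncomputable def weightPoly {F : Type*} [Field F] [Algebra (ZMod 2) F] (r m : ℕ)
    (S : Finset (ZMod r)) (α : F) : (ZMod 2)[X] :=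
  Function.invFun (Polynomial.map (algebraMap (ZMod 2) F)) (weightProd r m S α)

/-- The binary cyclic code of length `2 ^ m - 1` with generator polynomial
`weightPoly r m S α`. -/
noncomputable def weightCode {F : Type*} [Field F] [Algebra (ZMod 2) F] (r m : ℕ)
    (S : Finset (ZMod r)) (α : F) : BinaryCode (2 ^ m - 1) :=
  cyclic (2 ^ m - 1) (weightPoly r m S α)

theorem binaryWeight_bit0 (k : ℕ) : binaryWeight (2 * k) = binaryWeight k := by
  rcases Nat.eq_zero_or_pos k with rfl | hk
  · simp
  · unfold binaryWeight
    rw [Nat.digits_def' (by norm_num) (by omega)]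
    simp

theorem binaryWeight_bit1 (k : ℕ) : binaryWeight (2 * k + 1) = binaryWeight k + 1 := by
  unfold binaryWeight
  rw [Nat.digits_def' (by norm_num) (by omega)]
  have h1 : (2 * k + 1) % 2 = 1 := by omega
  have h2 : (2 * k + 1) / 2 = k := by omega
  rw [h1, h2, List.sum_cons, add_comm]

theorem binaryWeight_add_two_pow (p : ℕ) : ∀ k < 2 ^ p,
    binaryWeight (2 ^ p + k) = binaryWeight k + 1 := by
  induction p with
  | zero =>
    intro k hk
    have : k = 0 := by simpa using hk
    subst this
    simp [binaryWeight]
  | succ p ih =>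
    intro k hk
    have hp : 2 ^ (p + 1) = 2 * 2 ^ p := by ring
    obtain ⟨l, rfl | rfl⟩ : ∃ l, k = 2 * l ∨ k = 2 * l + 1 := ⟨k / 2, by omega⟩
    · rw [show 2 ^ (p + 1) + 2 * l = 2 * (2 ^ p + l) by ring, binaryWeight_bit0,
        binaryWeight_bit0, ih l (by omega)]
    · rw [show 2 ^ (p + 1) + (2 * l + 1) = 2 * (2 ^ p + l) + 1 by ring, binaryWeight_bit1,
        binaryWeight_bit1, ih l (by omega)]

/-- Doubling modulo `2 ^ m - 1` permutes `weightSet r m S`. -/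
theorem image_double_weightSet (r m : ℕ) (S : Finset (ZMod r)) :
    (weightSet r m S).image (fun j => 2 * j % (2 ^ m - 1)) = weightSet r m S := by
  rcases m with _ | p
  · have h : weightSet r 0 S = ∅ := by
      unfold weightSet
      rw [show Finset.Icc 1 (2 ^ 0 - 2) = ∅ by decide]
      rfl
    rw [h]
    rfl
  have hp : 2 ^ (p + 1) = 2 * 2 ^ p := by ring
  have hpos : 0 < 2 ^ p := by positivity
  have key : ∀ j, 1 ≤ j → j ≤ 2 ^ (p + 1) - 2 →
      (j < 2 ^ p ∧ 2 * j % (2 ^ (p + 1) - 1) = 2 * j) ∨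
      (2 ^ p ≤ j ∧ 2 * j % (2 ^ (p + 1) - 1) = 2 * (j - 2 ^ p) + 1) := by
    intro j h1 h2
    rcases lt_or_ge j (2 ^ p) with h | h
    · left
      exact ⟨h, Nat.mod_eq_of_lt (by omega)⟩
    · right
      refine ⟨h, ?_⟩
      rw [Nat.mod_eq_sub_mod (by omega), Nat.mod_eq_of_lt (by omega)]
      omega
  apply Finset.eq_of_subset_of_card_le
  · intro x hx
    obtain ⟨j, hj, rfl⟩ := Finset.mem_image.1 hx
    obtain ⟨hj1, hjS⟩ := Finset.mem_filter.1 hj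
    obtain ⟨h1, h2⟩ := Finset.mem_Icc.1 hj1
    rcases key j h1 h2 with ⟨h, e⟩ | ⟨h, e⟩
    · simp only [e]
      refine Finset.mem_filter.2 ⟨Finset.mem_Icc.2 ⟨by omega, by omega⟩, ?_⟩
      rwa [binaryWeight_bit0]
    · simp only [e]
      refine Finset.mem_filter.2 ⟨Finset.mem_Icc.2 ⟨by omega, by omega⟩, ?_⟩
      rw [binaryWeight_bit1, ← binaryWeight_add_two_pow p _ (by omega)]
      rwa [show 2 ^ p + (j - 2 ^ p) = j by omega]
  · rw [Finset.card_image_of_injOn]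
    intro i hi j hj hij
    obtain ⟨h1, h2⟩ := Finset.mem_Icc.1 (Finset.mem_filter.1 (Finset.mem_coe.1 hi)).1
    obtain ⟨h3, h4⟩ := Finset.mem_Icc.1 (Finset.mem_filter.1 (Finset.mem_coe.1 hj)).1
    simp only at hij
    rcases key i h1 h2 with ⟨h, e⟩ | ⟨h, e⟩ <;> rcases key j h3 h4 with ⟨h', e'⟩ | ⟨h', e'⟩ <;>
      rw [e, e'] at hij <;> omega

/-- The product of the linear factors is the image of the binary polynomial `weightPoly`. -/
theorem map_weightPoly {F : Type*} [Field F] [Algebra (ZMod 2) F] (r m : ℕ)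
    (S : Finset (ZMod r)) (α : F) (hα : α ^ (2 ^ m - 1) = 1) :
    (weightPoly r m S α).map (algebraMap (ZMod 2) F) = weightProd r m S α := by
  have : CharP F 2 := charP_of_injective_algebraMap (algebraMap (ZMod 2) F).injective 2
  have hinj : Set.InjOn (fun j => 2 * j % (2 ^ m - 1)) (weightSet r m S : Set ℕ) := by
    rw [← Finset.card_image_iff, image_double_weightSet]
  have hfrob : (weightProd r m S α).map (frobenius F 2) = weightProd r m S α := by
    unfold weightProd
    rw [Polynomial.map_prod]
    conv_rhs => rw [← image_double_weightSet, Finset.prod_image hinj]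
    refine Finset.prod_congr rfl fun j _ => ?_
    rw [Polynomial.map_sub, Polynomial.map_X, Polynomial.map_C, frobenius_def, ← pow_mul,
      ← pow_mod_orderOf α (j * 2), ← pow_mod_orderOf α (2 * j % (2 ^ m - 1)),
      Nat.mod_mod_of_dvd _ (orderOf_dvd_of_pow_eq_one hα), mul_comm j 2]
  refine Function.invFun_eq (f := Polynomial.map (algebraMap (ZMod 2) F)) ?_
  rw [← Polynomial.mem_lifts, Polynomial.lifts_iff_coeff_lifts]
  intro k
  have hk := congrArg (fun q => Polynomial.coeff q k) hfrob
  simp only [Polynomial.coeff_map, frobenius_def] at hk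
  set a := (weightProd r m S α).coeff k with ha
  have h0 : a * (a - 1) = 0 := by
    rw [mul_sub, mul_one, ← sq, hk, sub_self]
  rcases mul_eq_zero.1 h0 with h | h
  · exact ⟨0, by rw [map_zero, h]⟩
  · exact ⟨1, by rw [map_one, sub_eq_zero.1 h]⟩

end BinaryCode

/-! Put `n = 2 ^ m - 1` and `h = (m - 1) / 2`. Complementing all `m` bits sends `j` to `n - j` and
its weight `w` to `m - w`. Since `m = t` modulo `r`, multiplication by `-1` interchanges the
exponent sets of `S` and `Sᶜ`; this gives the splitting and the dimensions.

Parseval's identity (`sum_aeval_mul_aeval_inv`) expands the inner product of two codewords over the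
powers of `α`. For each `j ≠ 0`, `α ^ j` is a zero of the first word or `α ^ (-j)` of the second, so
only the product of the coordinate sums survives. Hence the dual is the even-weight subcode and the
extension is self-dual. Applied to a word and its cyclic shifts, the same formula fixes the parity
of all autocorrelations, and counting them in pairs `±k` gives weights modulo four
(`four_dvd_hammingNorm_add`).

For the distance, `a * (2 ^ h - 1)` with `1 ≤ a ≤ 2 ^ h` always has weight `h`, and its complement
has weight `h + 1`. Exactly one of `h`, `h + 1` lies in `S` modulo `r`, so up to inversion there are
`2 ^ h` consecutive zeros and the BCH bound applies. -/

namespace BinaryCode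

/-! ### Binary weights -/

theorem binaryWeight_add_complement (m : ℕ) : ∀ j < 2 ^ m,
    binaryWeight j + binaryWeight (2 ^ m - 1 - j) = m := by
  induction m with
  | zero =>
    intro j hj
    have : j = 0 := by simpa using hj
    subst this
    simp [binaryWeight]
  | succ p ih =>
    intro j hj
    have hp : 2 ^ (p + 1) = 2 * 2 ^ p := by ring
    obtain ⟨l, rfl | rfl⟩ : ∃ l, j = 2 * l ∨ j = 2 * l + 1 := ⟨j / 2, by omega⟩
    · rw [show 2 ^ (p + 1) - 1 - 2 * l = 2 * (2 ^ p - 1 - l) + 1 by omega, binaryWeight_bit0,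
        binaryWeight_bit1, ← add_assoc, ih l (by omega)]
    · rw [show 2 ^ (p + 1) - 1 - (2 * l + 1) = 2 * (2 ^ p - 1 - l) by omega, binaryWeight_bit0,
        binaryWeight_bit1, add_right_comm, ih l (by omega)]

theorem binaryWeight_mul_two_pow_add (h b : ℕ) : ∀ l < 2 ^ h,
    binaryWeight (b * 2 ^ h + l) = binaryWeight b + binaryWeight l := by
  induction h with
  | zero =>
    intro l hl
    have : l = 0 := by simpa using hl
    subst this
    simp [binaryWeight]
  | succ p ih =>
    intro l hl
    have hp : 2 ^ (p + 1) = 2 * 2 ^ p := by ring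
    obtain ⟨k, rfl | rfl⟩ : ∃ k, l = 2 * k ∨ l = 2 * k + 1 := ⟨l / 2, by omega⟩
    · rw [show b * 2 ^ (p + 1) + 2 * k = 2 * (b * 2 ^ p + k) by ring, binaryWeight_bit0,
        binaryWeight_bit0, ih k (by omega)]
    · rw [show b * 2 ^ (p + 1) + (2 * k + 1) = 2 * (b * 2 ^ p + k) + 1 by ring,
        binaryWeight_bit1, binaryWeight_bit1, ih k (by omega), add_assoc]

/-- The multiples `a * (2 ^ h - 1)` with `1 ≤ a ≤ 2 ^ h` all have binary weight `h`. -/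
theorem binaryWeight_mul_two_pow_sub_one (h a : ℕ) (ha : 1 ≤ a) (ha' : a ≤ 2 ^ h) :
    binaryWeight (a * (2 ^ h - 1)) = h := by
  obtain ⟨b, rfl⟩ : ∃ b, a = b + 1 := ⟨a - 1, by omega⟩
  -- With `b = a - 1`, the low `h` bits are the complement of the high part `b`, so the two weights
  -- add up to `h`.
  have e : (b + 1) * (2 ^ h - 1) = b * 2 ^ h + (2 ^ h - 1 - b) := by
    have h1 : 1 ≤ 2 ^ h := Nat.one_le_two_pow
    zify [h1, show b ≤ 2 ^ h - 1 by omega]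
    ring
  rw [e, binaryWeight_mul_two_pow_add h b _ (by omega), binaryWeight_add_complement h b (by omega)]

/-! ### Words and their polynomials -/

theorem coeff_wordPoly {n : ℕ} (c : Fin n → ZMod 2) (i : Fin n) :
    (wordPoly c).coeff i = c i := by
  simp only [wordPoly, finsetSum_coeff, coeff_C_mul, coeff_X_pow, Fin.val_inj]
  simp

theorem degree_wordPoly_lt {n : ℕ} (c : Fin n → ZMod 2) : (wordPoly c).degree < n := by
  rw [← mem_degreeLT]
  refine Submodule.sum_mem _ fun i _ => ?_
  rw [mem_degreeLT]
  exact (degree_C_mul_X_pow_le _ _).trans_lt (by exact_mod_cast i.2)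

theorem wordPoly_coeff {n : ℕ} {p : (ZMod 2)[X]} (hp : p.degree < n) :
    wordPoly (fun i : Fin n => p.coeff i) = p := by
  ext k
  rcases lt_or_ge k n with hk | hk
  · exact coeff_wordPoly _ ⟨k, hk⟩
  · rw [coeff_eq_zero_of_degree_lt (hp.trans_le (by exact_mod_cast hk)),
      coeff_eq_zero_of_degree_lt ((degree_wordPoly_lt _).trans_le (by exact_mod_cast hk))]

theorem aeval_wordPoly {F : Type*} [Field F] [Algebra (ZMod 2) F] {n : ℕ} (c : Fin n → ZMod 2)
    (x : F) : aeval x (wordPoly c) = ∑ i, algebraMap (ZMod 2) F (c i) * x ^ (i : ℕ) := by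
  simp [wordPoly]

/-- Multiplication by `g` identifies the polynomials of degree below `n - deg g` with the codewords.
If `deg g > n`, the truncated difference is `0` and so is the code. -/
theorem finrank_cyclic {n : ℕ} {g : (ZMod 2)[X]} (hg : g ≠ 0) :
    Module.finrank (ZMod 2) (cyclic n g) = n - g.natDegree := by
  let φ : degreeLT (ZMod 2) (n - g.natDegree) →ₗ[ZMod 2] (Fin n → ZMod 2) :=
    (LinearMap.pi fun i : Fin n => lcoeff (ZMod 2) i) ∘ₗ
      (LinearMap.mulLeft (ZMod 2) g) ∘ₗ (degreeLT (ZMod 2) (n - g.natDegree)).subtype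
  have hdeg : ∀ q : degreeLT (ZMod 2) (n - g.natDegree), (g * q : (ZMod 2)[X]).degree < n := by
    rintro ⟨q, hq⟩
    rcases eq_or_ne q 0 with rfl | h0
    · simp
    · rw [mem_degreeLT, degree_eq_natDegree h0, Nat.cast_lt] at hq
      rw [degree_eq_natDegree (mul_ne_zero hg h0), natDegree_mul hg h0, Nat.cast_lt]
      omega
  have hφ : ∀ q, wordPoly (φ q) = g * q := fun q => wordPoly_coeff (hdeg q)
  have hinj : Function.Injective φ := by
    rw [injective_iff_map_eq_zero]
    intro q hq
    have h := hφ q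
    rw [hq] at h
    have h' : g * (q : (ZMod 2)[X]) = 0 := by rw [← h]; simp [wordPoly]
    exact Subtype.ext ((mul_eq_zero.1 h').resolve_left hg)
  have hrange : φ.range = cyclic n g := by
    ext c
    constructor
    · rintro ⟨q, rfl⟩
      exact ⟨q, hφ q⟩
    · rintro ⟨q, hq⟩
      have hq' : q ∈ degreeLT (ZMod 2) (n - g.natDegree) := by
        rw [mem_degreeLT]
        rcases eq_or_ne q 0 with rfl | h0
        · exact degree_zero.trans_lt (WithBot.bot_lt_coe _)
        · have h := degree_wordPoly_lt c
          rw [hq, degree_eq_natDegree (mul_ne_zero hg h0), natDegree_mul hg h0, Nat.cast_lt] at h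
          rw [degree_eq_natDegree h0, Nat.cast_lt]
          omega
      refine ⟨⟨q, hq'⟩, ?_⟩
      funext i
      rw [← coeff_wordPoly (φ _) i, hφ, ← coeff_wordPoly c i, hq]
  rw [← hrange, LinearMap.finrank_range_of_inj hinj, (degreeLTEquiv (ZMod 2) _).finrank_eq,
    Module.finrank_fin_fun]

/-! ### Cyclic codes with prescribed zeros -/

section Zeros

variable {F : Type*} [Field F] {n : ℕ} {α : F} {g : (ZMod 2)[X]} {T : Finset ℕ}

theorem prod_X_sub_C_dvd_iff (hα : IsPrimitiveRoot α n) (hT : ∀ j ∈ T, j < n) (p : F[X]) :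
    ∏ j ∈ T, (X - C (α ^ j)) ∣ p ↔ ∀ j ∈ T, p.eval (α ^ j) = 0 := by
  constructor
  · intro h j hj
    have h' : X - C (α ^ j) ∣ p :=
      (Finset.dvd_prod_of_mem (fun j => X - C (α ^ j)) hj).trans h
    exact (dvd_iff_isRoot.1 h').eq_zero
  · intro h
    refine Finset.prod_dvd_of_coprime (fun i hi j hj hij => ?_) fun j hj => dvd_iff_isRoot.2 (h j hj)
    refine isCoprime_X_sub_C_of_isUnit_sub (sub_ne_zero.2 fun e => hij ?_).isUnit
    exact hα.pow_inj (hT i hi) (hT j hj) e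

variable [Algebra (ZMod 2) F]

theorem dvd_iff_aeval_eq_zero (hα : IsPrimitiveRoot α n) (hT : ∀ j ∈ T, j < n)
    (hg : g.map (algebraMap (ZMod 2) F) = ∏ j ∈ T, (X - C (α ^ j))) (p : (ZMod 2)[X]) :
    g ∣ p ↔ ∀ j ∈ T, aeval (α ^ j) p = 0 := by
  rw [← map_dvd_map' (algebraMap (ZMod 2) F), hg, prod_X_sub_C_dvd_iff hα hT]
  simp only [aeval_def, eval_map]

theorem dvd_X_pow_sub_one (hα : IsPrimitiveRoot α n) (hT : ∀ j ∈ T, j < n)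
    (hg : g.map (algebraMap (ZMod 2) F) = ∏ j ∈ T, (X - C (α ^ j))) : g ∣ X ^ n - 1 := by
  rw [dvd_iff_aeval_eq_zero hα hT hg]
  intro j _
  rw [map_sub, map_pow, aeval_X, map_one, ← pow_mul, mul_comm, pow_mul, hα.pow_eq_one, one_pow,
    sub_self]

theorem aeval_eq_zero_iff (hα : IsPrimitiveRoot α n) (hT : ∀ j ∈ T, j < n)
    (hg : g.map (algebraMap (ZMod 2) F) = ∏ j ∈ T, (X - C (α ^ j))) {i : ℕ} (hi : i < n) :
    aeval (α ^ i) g = 0 ↔ i ∈ T := by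
  rw [aeval_def, ← eval_map, hg, eval_prod, Finset.prod_eq_zero_iff]
  constructor
  · rintro ⟨j, hj, h⟩
    rw [eval_sub, eval_X, eval_C, sub_eq_zero] at h
    rwa [hα.pow_inj hi (hT j hj) h]
  · intro h
    exact ⟨i, h, by simp⟩

theorem hasDefiningSet_cyclic [NeZero n] (hα : IsPrimitiveRoot α n) (hT : ∀ j ∈ T, j < n)
    (hg : g.map (algebraMap (ZMod 2) F) = ∏ j ∈ T, (X - C (α ^ j))) :
    HasDefiningSet α (cyclic n g) {i : ZMod n | i.val ∈ T} := by
  refine ⟨g, dvd_X_pow_sub_one hα hT hg, rfl, ?_⟩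
  ext i
  exact (aeval_eq_zero_iff hα hT hg i.val_lt).symm

theorem finrank_cyclic_of_map
    (hg : g.map (algebraMap (ZMod 2) F) = ∏ j ∈ T, (X - C (α ^ j))) :
    Module.finrank (ZMod 2) (cyclic n g) = n - T.card := by
  have hm : (∏ j ∈ T, (X - C (α ^ j))).Monic := monic_prod_of_monic _ _ fun j _ => monic_X_sub_C _
  have h0 : g ≠ 0 := by
    rintro rfl
    rw [Polynomial.map_zero] at hg
    exact hm.ne_zero hg.symm
  rw [finrank_cyclic h0, ← natDegree_map (algebraMap (ZMod 2) F), hg,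
    natDegree_prod_of_monic _ _ fun j _ => monic_X_sub_C _]
  simp only [natDegree_X_sub_C, Finset.sum_const, smul_eq_mul, mul_one]

end Zeros

/-! ### The BCH bound -/

/-- A nonzero word whose polynomial vanishes at `δ` consecutive powers of a primitive `n`-th root
of unity has weight greater than `δ`. -/
theorem lt_hammingNorm_of_consecutive_zeros {F : Type*} [Field F] [Algebra (ZMod 2) F] {n : ℕ}
    {γ : F} (hγ : IsPrimitiveRoot γ n) (b δ : ℕ) {c : Fin n → ZMod 2} (hc : c ≠ 0)
    (hz : ∀ a < δ, aeval (γ ^ (b + a)) (wordPoly c) = 0) : δ < hammingNorm c := by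
  classical
  by_contra! hle
  obtain ⟨i₀, hi₀⟩ := Function.ne_iff.1 hc
  set s : Finset (Fin n) := {i | c i ≠ 0} with hs
  have hi₀s : i₀ ∈ s := by simpa [hs] using hi₀
  have hcard : s.card ≤ δ := hle
  -- If the weight is at most `δ`, this `p` has degree below `δ` and vanishes at every support point
  -- but `i₀`. It replaces the Vandermonde determinant: the coefficients of `p` combine the `δ`
  -- vanishing conditions into one whose only surviving term is nonzero.
  set p : F[X] := ∏ i ∈ s.erase i₀, (X - C (γ ^ (i : ℕ))) with hp
  have hdeg : p.natDegree < δ := by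
    rw [hp, natDegree_prod_of_monic _ _ fun j _ => monic_X_sub_C _]
    simp only [natDegree_X_sub_C, Finset.sum_const, smul_eq_mul, mul_one]
    rw [Finset.card_erase_of_mem hi₀s]
    have : 0 < s.card := Finset.card_pos.2 ⟨i₀, hi₀s⟩
    omega
  have hsum : ∑ i, algebraMap (ZMod 2) F (c i) * (γ ^ (i : ℕ)) ^ b * p.eval (γ ^ (i : ℕ)) = 0 := by
    have : ∀ i : Fin n, algebraMap (ZMod 2) F (c i) * (γ ^ (i : ℕ)) ^ b * p.eval (γ ^ (i : ℕ)) =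
        ∑ a ∈ Finset.range δ,
          p.coeff a * (algebraMap (ZMod 2) F (c i) * (γ ^ (b + a)) ^ (i : ℕ)) := by
      intro i
      rw [eval_eq_sum_range' hdeg, Finset.mul_sum]
      refine Finset.sum_congr rfl fun a _ => ?_
      rw [← pow_mul, ← pow_mul, ← pow_mul, add_mul, pow_add, mul_comm b, mul_comm a]
      ring
    simp_rw [this]
    rw [Finset.sum_comm]
    refine Finset.sum_eq_zero fun a ha => ?_
    rw [← Finset.mul_sum, ← aeval_wordPoly, hz a (Finset.mem_range.1 ha), mul_zero]
  rw [Finset.sum_eq_single i₀] at hsum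
  · have hγ0 : γ ≠ 0 := hγ.ne_zero i₀.pos.ne'
    have h1 : algebraMap (ZMod 2) F (c i₀) ≠ 0 := by
      rw [Ne, map_eq_zero]
      exact hi₀
    refine mul_ne_zero (mul_ne_zero h1 (pow_ne_zero _ (pow_ne_zero _ hγ0))) ?_ hsum
    rw [hp, eval_prod, Finset.prod_ne_zero_iff]
    intro i hi
    rw [eval_sub, eval_X, eval_C, sub_ne_zero]
    intro e
    exact (Finset.mem_erase.1 hi).1 (Fin.ext (hγ.pow_inj i.2 i₀.2 e.symm))
  · intro i _ hi
    by_cases h : c i = 0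
    · simp [h]
    · have : p.eval (γ ^ (i : ℕ)) = 0 := by
        rw [hp, eval_prod]
        refine Finset.prod_eq_zero (Finset.mem_erase.2 ⟨hi, ?_⟩) (by simp : _ = (0 : F))
        simpa [hs] using h
      rw [this, mul_zero]
  · simp

/-! ### Minimum weight and the dimension of the dual -/

theorem le_minDist {n : ℕ} {D : BinaryCode n} {δ : ℕ} (hD : D ≠ ⊥)
    (h : ∀ c ∈ D, c ≠ 0 → δ ≤ hammingNorm c) : δ ≤ D.minDist := by
  obtain ⟨c, hc, hc0⟩ := D.ne_bot_iff.1 hD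
  refine le_csInf ⟨_, c, hc, 0, D.zero_mem, hc0, rfl⟩ ?_
  rintro d ⟨x, hx, y, hy, hxy, rfl⟩
  rw [hammingDist_comm, hammingDist_eq_hammingNorm]
  refine h _ (D.add_mem (D.neg_mem hy) hx) fun e => hxy ?_
  rwa [neg_add_eq_zero, eq_comm] at e

theorem finrank_dual {n : ℕ} (D : BinaryCode n) :
    Module.finrank (ZMod 2) D.dual = n - Module.finrank (ZMod 2) D := by
  let B : LinearMap.BilinForm (ZMod 2) (Fin n → ZMod 2) := dotProductBilin (ZMod 2) (ZMod 2)
  have hB : B.Nondegenerate := by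
    refine ⟨fun x hx => ?_, fun x hx => ?_⟩
    · funext i
      simpa [B, dotProductBilin] using hx (Pi.single i 1)
    · funext i
      simpa [B, dotProductBilin] using hx (Pi.single i 1)
  have : D.dual = B.orthogonal D := by
    ext x
    refine forall₂_congr fun c _ => ?_
    simp [B, dotProductBilin, dotProduct, mul_comm]
  rw [this, LinearMap.BilinForm.finrank_orthogonal hB, Module.finrank_fin_fun]

/-! ### Inner products and zeros -/

section Orthogonality

variable {F : Type*} [Field F] [Algebra (ZMod 2) F] {n : ℕ} {α : F}

/-- Parseval's identity for the discrete Fourier transform. The usual factor `n` equals `1`, because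
`n` is odd and the characteristic is two. -/
theorem sum_aeval_mul_aeval_inv (hα : IsPrimitiveRoot α n) (hn : Odd n) (c e : Fin n → ZMod 2) :
    ∑ j ∈ Finset.range n, aeval (α ^ j) (wordPoly c) * aeval ((α ^ j)⁻¹) (wordPoly e) =
      algebraMap (ZMod 2) F (∑ i, c i * e i) := by
  have hchar : CharP F 2 := charP_of_injective_algebraMap (algebraMap (ZMod 2) F).injective 2
  have hn1 : (n : F) = 1 := by
    obtain ⟨k, rfl⟩ := hn
    rw [Nat.cast_add, Nat.cast_mul, Nat.cast_one, show ((2 : ℕ) : F) = 0 from CharP.cast_eq_zero F 2,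
      zero_mul, zero_add]
  have hα0 : α ≠ 0 := hα.ne_zero hn.pos.ne'
  have hgeom : ∀ i k : Fin n,
      ∑ j ∈ Finset.range n, (α ^ (i : ℕ) * (α ^ (k : ℕ))⁻¹) ^ j = if i = k then 1 else 0 := by
    intro i k
    split_ifs with h
    · subst h
      rw [mul_inv_cancel₀ (pow_ne_zero _ hα0)]
      simp [hn1]
    · have h1 : α ^ (i : ℕ) * (α ^ (k : ℕ))⁻¹ ≠ 1 := by
        intro h'
        rw [mul_inv_eq_one₀ (pow_ne_zero _ hα0)] at h'
        exact h (Fin.ext (hα.pow_inj i.2 k.2 h'))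
      rw [geom_sum_eq h1, mul_pow, inv_pow, ← pow_mul, ← pow_mul, mul_comm (i : ℕ),
        mul_comm (k : ℕ), pow_mul, pow_mul, hα.pow_eq_one]
      simp
  have hterm : ∀ j ∈ Finset.range n,
      aeval (α ^ j) (wordPoly c) * aeval ((α ^ j)⁻¹) (wordPoly e) =
        ∑ i : Fin n, ∑ k : Fin n, algebraMap (ZMod 2) F (c i) * algebraMap (ZMod 2) F (e k) *
          (α ^ (i : ℕ) * (α ^ (k : ℕ))⁻¹) ^ j := by
    intro j _
    rw [aeval_wordPoly, aeval_wordPoly, Finset.sum_mul_sum]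
    refine Finset.sum_congr rfl fun i _ => Finset.sum_congr rfl fun k _ => ?_
    rw [mul_pow, inv_pow, inv_pow, ← pow_mul, ← pow_mul, ← pow_mul, ← pow_mul, mul_comm j,
      mul_comm j]
    ring
  rw [Finset.sum_congr rfl hterm, Finset.sum_comm]
  simp_rw [Finset.sum_comm (s := Finset.range n), ← Finset.mul_sum, hgeom]
  simp

/-- If at every nontrivial power of `α` one of the two words vanishes (after inversion, for the
second one), then their inner product is the product of their coordinate sums. -/
theorem sum_mul_eq_sum_mul_sum (hα : IsPrimitiveRoot α n) (hn : Odd n) {c e : Fin n → ZMod 2}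
    (h : ∀ j, 0 < j → j < n →
      aeval (α ^ j) (wordPoly c) = 0 ∨ aeval (α ^ (n - j)) (wordPoly e) = 0) :
    ∑ i, c i * e i = (∑ i, c i) * ∑ i, e i := by
  refine (algebraMap (ZMod 2) F).injective ?_
  rw [← sum_aeval_mul_aeval_inv hα hn, Finset.sum_eq_single_of_mem 0 (Finset.mem_range.2 hn.pos)]
  · simp [aeval_wordPoly]
  · intro j hj hj0
    have hjn := Finset.mem_range.1 hj
    have hinv : (α ^ j)⁻¹ = α ^ (n - j) := by
      refine inv_eq_of_mul_eq_one_right ?_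
      rw [← pow_add, Nat.add_sub_cancel' hjn.le, hα.pow_eq_one]
    rw [hinv]
    rcases h j (Nat.pos_of_ne_zero hj0) hjn with h | h <;> simp [h]

/-- At an `n`-th root of unity a cyclic shift only changes the value by a unit, so codes given by
such zeros are closed under shifts. -/
theorem aeval_wordPoly_shift [NeZero n] (c : Fin n → ZMod 2) (k : Fin n) {x : F} (hx : x ^ n = 1) :
    aeval x (wordPoly fun i => c (i + k)) * x ^ (k : ℕ) = aeval x (wordPoly c) := by
  rw [aeval_wordPoly, aeval_wordPoly, Finset.sum_mul,
    ← Equiv.sum_comp (Equiv.addRight k) fun i => algebraMap (ZMod 2) F (c i) * x ^ (i : ℕ)]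
  refine Finset.sum_congr rfl fun i _ => ?_
  rw [Equiv.coe_addRight, mul_assoc, ← pow_add, Fin.val_add, ← pow_eq_pow_mod _ hx]

end Orthogonality

/-! ### Weights modulo four -/

theorem hammingNorm_eq_sum_val {n : ℕ} (c : Fin n → ZMod 2) :
    hammingNorm c = ∑ i, (c i).val := by
  rw [hammingNorm, Finset.card_filter]
  refine Finset.sum_congr rfl fun i _ => ?_
  generalize c i = a
  revert a
  decide

theorem cast_hammingNorm {n : ℕ} (c : Fin n → ZMod 2) : (hammingNorm c : ZMod 2) = ∑ i, c i := by
  simp [hammingNorm_eq_sum_val]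

/-- For odd `n`, negation has no fixed point besides `0`, so the halves `f k / 2` cancel in pairs
modulo two. -/
theorem four_dvd_sum_of_neg_eq {n : ℕ} [NeZero n] (hn : Odd n) (f : Fin n → ℕ)
    (heven : ∀ k, 2 ∣ f k) (hneg : ∀ k, f (-k) = f k) : 4 ∣ ∑ k ∈ Finset.univ.erase 0, f k := by
  choose g hg using heven
  have hgneg : ∀ k, g (-k) = g k := fun k => by
    have := hneg k
    rw [hg, hg] at this
    omega
  simp_rw [hg]
  rw [← Finset.mul_sum]
  refine mul_dvd_mul_left 2 (?_ : 2 ∣ _)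
  rw [← ZMod.natCast_eq_zero_iff, Nat.cast_sum]
  refine Finset.sum_involution (fun k _ => -k) ?_ ?_ ?_ ?_
  · intro k _
    rw [hgneg]
    exact CharTwo.add_self_eq_zero _
  · intro k hk _ h
    have h0 : k + k = 0 := by
      nth_rw 1 [← h]
      exact neg_add_cancel k
    have h1 := congrArg Fin.val h0
    rw [Fin.val_add, Fin.val_zero] at h1
    have hk0 : (k : ℕ) ≠ 0 := fun e => (Finset.mem_erase.1 hk).1 (Fin.ext (by simpa using e))
    obtain ⟨q, hq⟩ := Nat.dvd_of_mod_eq_zero h1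
    have hk' := k.2
    obtain ⟨l, hl⟩ := hn
    -- From `2 * k = n * q` with `0 < k < n`: `q = 0` forces `k = 0`, `q = 1` makes `n` even, and `q
    -- ≥ 2` is too large.
    rcases q with _ | _ | q
    · omega
    · omega
    · nlinarith
  · intro k hk
    simpa using hk
  · intro k _
    exact neg_neg k

/-- A word whose inner products with all its cyclic shifts have the parity of its weight has
weight divisible by four, up to an overall parity check. -/
theorem four_dvd_hammingNorm_add {n : ℕ} [NeZero n] (hn : n % 4 = 3) (c : Fin n → ZMod 2)
    (h : ∀ k, ∑ i, c i * c (i + k) = ∑ i, c i) : 4 ∣ hammingNorm c + hammingNorm c % 2 := by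
  set w := hammingNorm c with hw
  -- The integer autocorrelations: they sum to `w ^ 2`, `N 0 = w`, `N` is even in `k`, and each `N
  -- k` has the parity of `w`.
  let N : Fin n → ℕ := fun k => ∑ i, (c i).val * (c (i + k)).val
  have hsum : ∑ k, N k = w * w := by
    simp only [N]
    rw [Finset.sum_comm, hw, hammingNorm_eq_sum_val, Finset.sum_mul]
    refine Finset.sum_congr rfl fun i _ => ?_
    rw [← Finset.mul_sum]
    congr 1
    exact Equiv.sum_comp (Equiv.addLeft i) fun k => (c k).val
  have hzero : N 0 = w := by
    simp only [N, hw, hammingNorm_eq_sum_val, add_zero]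
    refine Finset.sum_congr rfl fun i _ => ?_
    generalize c i = a
    revert a
    decide
  have hneg : ∀ k, N (-k) = N k := by
    intro k
    simp only [N]
    rw [← Equiv.sum_comp (Equiv.addRight k)]
    refine Finset.sum_congr rfl fun i _ => ?_
    rw [Equiv.coe_addRight, add_neg_cancel_right, mul_comm]
  have hparity : ∀ k, 2 ∣ N k + w % 2 := by
    intro k
    rw [← ZMod.natCast_eq_zero_iff, Nat.cast_add, ZMod.natCast_mod, hw, cast_hammingNorm]
    simp only [N, Nat.cast_sum, Nat.cast_mul, ZMod.natCast_val, ZMod.cast_id', id]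
    rw [h k]
    exact CharTwo.add_self_eq_zero _
  have hodd : Odd n := Nat.odd_iff.2 (by omega)
  have h4 := four_dvd_sum_of_neg_eq hodd (fun k => N k + w % 2) hparity (fun k => by rw [hneg])
  rw [Finset.sum_add_distrib, Finset.sum_const, Finset.card_erase_of_mem (Finset.mem_univ _),
    Finset.card_univ, Fintype.card_fin, smul_eq_mul] at h4
  rw [← Finset.add_sum_erase _ _ (Finset.mem_univ 0), hzero] at hsum
  obtain ⟨q, rfl⟩ : ∃ q, n = 4 * q + 3 := ⟨n / 4, by omega⟩
  rw [show 4 * q + 3 - 1 = 4 * q + 2 by omega] at h4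
  -- As `n - 1` is `2` modulo `4`, `h4` says that `w ^ 2 - w + 2 * (w % 2)` is divisible by four.
  -- This leaves only the residues `0` and `3` for `w`.
  obtain ⟨a, b, hb, hab⟩ : ∃ a b, b < 4 ∧ w = 4 * a + b :=
    ⟨w / 4, w % 4, Nat.mod_lt _ (by norm_num), by omega⟩
  have hsq : w * w = 4 * (4 * a * a + 2 * a * b) + b * b := by rw [hab]; ring
  rw [hsq] at hsum
  generalize 4 * a * a + 2 * a * b = y at hsum
  have hw2 : w % 2 = b % 2 := by omega
  rw [hw2] at h4 ⊢
  interval_cases b <;> norm_num at h4 hsum ⊢ <;> omega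

/-! ### Extended codes -/

section Extended

variable {n : ℕ} {D : BinaryCode n}

theorem mem_extended_iff {x : Fin (n + 1) → ZMod 2} :
    x ∈ D.extended ↔ (fun i : Fin n => x i.castSucc) ∈ D ∧
      x (Fin.last n) = ∑ i : Fin n, x i.castSucc := by
  refine and_congr_right fun _ => ?_
  rw [Fin.sum_univ_castSucc, add_comm, CharTwo.add_eq_zero]

theorem finrank_extended : Module.finrank (ZMod 2) D.extended = Module.finrank (ZMod 2) D := by
  let ρ : (Fin (n + 1) → ZMod 2) →ₗ[ZMod 2] (Fin n → ZMod 2) :=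
    LinearMap.funLeft (ZMod 2) (ZMod 2) Fin.castSucc
  have hρ : ∀ x ∈ D.extended, ρ x ∈ D := fun x hx => hx.1
  refine (LinearEquiv.ofBijective (ρ.restrict hρ) ⟨?_, ?_⟩).finrank_eq
  · rw [injective_iff_map_eq_zero]
    rintro ⟨x, hx⟩ h
    have h0 : ∀ i : Fin n, x i.castSucc = 0 := fun i => congrFun (congrArg Subtype.val h) i
    refine Subtype.ext (funext fun i => ?_)
    refine Fin.lastCases ?_ h0 i
    refine (mem_extended_iff.1 hx).2.trans ?_
    exact Finset.sum_eq_zero fun i _ => h0 i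
  · rintro ⟨c, hc⟩
    refine ⟨⟨Fin.snoc c (∑ i, c i), mem_extended_iff.2 ⟨?_, ?_⟩⟩, ?_⟩
    · simpa using hc
    · simp
    · refine Subtype.ext (funext fun i => ?_)
      exact Fin.snoc_castSucc (α := fun _ => ZMod 2) _ _ _

theorem hammingNorm_extended {x : Fin (n + 1) → ZMod 2} (hx : x ∈ D.extended) :
    hammingNorm x = hammingNorm (fun i : Fin n => x i.castSucc) +
      hammingNorm (fun i : Fin n => x i.castSucc) % 2 := by
  rw [hammingNorm_eq_sum_val, Fin.sum_univ_castSucc, (mem_extended_iff.1 hx).2,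
    ← cast_hammingNorm (fun i : Fin n => x i.castSucc), ZMod.val_natCast, hammingNorm_eq_sum_val]

/-- The parity coordinates contribute the product of the coordinate sums once more, which cancels
the inner product in characteristic two. Self-orthogonality and half dimension then suffice. -/
theorem isSelfDual_extended
    (h : ∀ c ∈ D, ∀ e ∈ D, ∑ i, c i * e i = (∑ i, c i) * ∑ i, e i)
    (hD : n + 1 = 2 * Module.finrank (ZMod 2) D) : D.extended.IsSelfDual := by
  refine (Submodule.eq_of_le_of_finrank_eq (fun x hx y hy => ?_) ?_).symm
  · obtain ⟨hx1, hx2⟩ := mem_extended_iff.1 hx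
    obtain ⟨hy1, hy2⟩ := mem_extended_iff.1 hy
    rw [Fin.sum_univ_castSucc, hx2, hy2, h _ hx1 _ hy1]
    exact CharTwo.add_self_eq_zero _
  · rw [finrank_dual, finrank_extended]
    omega

end Extended

/-! ### The codes defined by binary weights -/

section WeightCode

theorem two_pow_sub_one_mod_four {m : ℕ} (hm3 : 3 ≤ m) : (2 ^ m - 1) % 4 = 3 := by
  obtain ⟨k, rfl⟩ := Nat.exists_eq_add_of_le hm3
  rw [pow_add]
  have := Nat.one_le_two_pow (n := k)
  omega

theorem lt_of_mem_weightSet {r m : ℕ} {S : Finset (ZMod r)} {j : ℕ} (hj : j ∈ weightSet r m S) :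
    j < 2 ^ m - 1 := by
  obtain ⟨h1, h2⟩ := Finset.mem_Icc.1 (Finset.mem_filter.1 hj).1
  omega

theorem mem_weightSet_iff {r m : ℕ} {S : Finset (ZMod r)} {j : ℕ} (h0 : 0 < j)
    (hj : j < 2 ^ m - 1) : j ∈ weightSet r m S ↔ (binaryWeight j : ZMod r) ∈ S := by
  rw [weightSet, Finset.mem_filter, Finset.mem_Icc]
  exact and_iff_right ⟨h0, by omega⟩

theorem zero_notMem_weightSet {r m : ℕ} {S : Finset (ZMod r)} : 0 ∉ weightSet r m S := by
  simp [weightSet]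

theorem cyclotomicCoset_subset {r m : ℕ} {S : Finset (ZMod r)} (hm : 2 < 2 ^ m - 1)
    {s : ZMod (2 ^ m - 1)} (hs : s.val ∈ weightSet r m S) :
    cyclotomicCoset s ⊆ {i : ZMod (2 ^ m - 1) | i.val ∈ weightSet r m S} := by
  rintro x ⟨k, rfl⟩
  induction k with
  | zero => simpa using hs
  | succ k ih =>
    have ih' : (s * 2 ^ k).val ∈ weightSet r m S := ih
    have h := Finset.mem_image_of_mem (fun j => 2 * j % (2 ^ m - 1)) ih'
    rw [image_double_weightSet] at h
    have e : (s * 2 ^ (k + 1)).val = 2 * (s * 2 ^ k).val % (2 ^ m - 1) := by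
      have h2 : (2 : ZMod (2 ^ m - 1)).val = 2 := by
        have := ZMod.val_natCast_of_lt hm
        rwa [Nat.cast_ofNat] at this
      rw [pow_succ, ← mul_assoc, mul_comm _ 2, ZMod.val_mul, h2]
    rw [Set.mem_ofPred_eq, e]
    exact h

section Codes

variable {F : Type*} [Field F] [Algebra (ZMod 2) F] {r m : ℕ} {α : F} {S : Finset (ZMod r)}

theorem mem_weightCode_iff (hα : IsPrimitiveRoot α (2 ^ m - 1)) {c : Fin (2 ^ m - 1) → ZMod 2} :
    c ∈ weightCode r m S α ↔ ∀ j ∈ weightSet r m S, aeval (α ^ j) (wordPoly c) = 0 :=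
  dvd_iff_aeval_eq_zero hα (fun _ => lt_of_mem_weightSet) (map_weightPoly r m S α hα.pow_eq_one) _

/-- The binary polynomial with the additional zero `1`, which generates the even weight words. -/
theorem map_X_sub_one_mul_weightPoly (hα : IsPrimitiveRoot α (2 ^ m - 1)) :
    ((X - 1) * weightPoly r m S α).map (algebraMap (ZMod 2) F) =
      ∏ j ∈ insert 0 (weightSet r m S), (X - C (α ^ j)) := by
  rw [Finset.prod_insert zero_notMem_weightSet, Polynomial.map_mul,
    map_weightPoly r m S α hα.pow_eq_one, weightProd]
  simp

theorem hasDefiningSet_weightCode (hα : IsPrimitiveRoot α (2 ^ m - 1)) (hm3 : 3 ≤ m) :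
    HasDefiningSet α (weightCode r m S α) {i : ZMod (2 ^ m - 1) | i.val ∈ weightSet r m S} := by
  have h4 := two_pow_sub_one_mod_four hm3
  have : NeZero (2 ^ m - 1) := ⟨by omega⟩
  exact hasDefiningSet_cyclic hα (fun _ => lt_of_mem_weightSet)
    (map_weightPoly r m S α hα.pow_eq_one)

end Codes

/-! ### Complementary exponents and runs of zeros -/

variable {F : Type*} [Field F] {r m : ℕ} {α : F} {S : Finset (ZMod r)}

variable [NeZero r]

theorem mem_weightSet_compl_iff (hS : ∀ i : ZMod r, i ∈ Sᶜ ↔ (m : ZMod r) - i ∈ S) {j : ℕ}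
    (h0 : 0 < j) (hj : j < 2 ^ m - 1) :
    j ∈ weightSet r m Sᶜ ↔ 2 ^ m - 1 - j ∈ weightSet r m S := by
  rw [mem_weightSet_iff h0 hj, mem_weightSet_iff (by omega) (by omega), hS]
  have h := congrArg (Nat.cast (R := ZMod r)) (binaryWeight_add_complement m j (by omega))
  rw [← h, Nat.cast_add, add_sub_cancel_left]

theorem mem_or_mem_weightSet_compl {j : ℕ} (h0 : 0 < j) (hj : j < 2 ^ m - 1) :
    j ∈ weightSet r m S ∨ j ∈ weightSet r m Sᶜ := by
  rw [mem_weightSet_iff h0 hj, mem_weightSet_iff h0 hj, Finset.mem_compl]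
  exact em _

theorem card_weightSet (hm : 1 ≤ m) (hS : ∀ i : ZMod r, i ∈ Sᶜ ↔ (m : ZMod r) - i ∈ S) :
    (weightSet r m S).card = 2 ^ (m - 1) - 1 := by
  have hpos : ∀ {R : Finset (ZMod r)} {j : ℕ}, j ∈ weightSet r m R → 0 < j := fun h =>
    Nat.pos_of_ne_zero fun e => zero_notMem_weightSet (e ▸ h)
  have h1 : (weightSet r m Sᶜ).card = (weightSet r m S).card := by
    -- Complementation is its own inverse, so both exponent sets are half of the `2 ^ m - 2` nonzero
    -- residues.
    refine Finset.card_nbij' (fun j => 2 ^ m - 1 - j) (fun j => 2 ^ m - 1 - j) ?_ ?_ ?_ ?_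
    · intro j hj
      exact (mem_weightSet_compl_iff hS (hpos hj) (lt_of_mem_weightSet hj)).1 hj
    · intro j hj
      have h0 := hpos hj
      have hlt := lt_of_mem_weightSet hj
      refine (mem_weightSet_compl_iff hS (Nat.sub_pos_of_lt hlt) (Nat.sub_lt (h0.trans hlt) h0)).2 ?_
      rwa [Nat.sub_sub_self hlt.le]
    · intro j hj
      exact Nat.sub_sub_self (lt_of_mem_weightSet hj).le
    · intro j hj
      exact Nat.sub_sub_self (lt_of_mem_weightSet hj).le
  have h2 : (weightSet r m S).card + (weightSet r m Sᶜ).card = 2 ^ m - 2 := by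
    have := Finset.card_filter_add_card_filter_not (s := Finset.Icc 1 (2 ^ m - 2))
      fun j => (binaryWeight j : ZMod r) ∈ S
    simpa [weightSet] using this
  have h3 : 2 ^ m = 2 * 2 ^ (m - 1) := by
    rw [← pow_succ', Nat.sub_add_cancel hm]
  omega

/-- The exponents in `weightSet` give `2 ^ h` consecutive powers of a primitive root of unity. -/
theorem exists_consecutive_zeros {h : ℕ} (hα : IsPrimitiveRoot α (2 ^ (2 * h + 1) - 1)) (hh : 1 ≤ h)
    (hS : ∀ i : ZMod r, i ∈ Sᶜ ↔ ((2 * h + 1 : ℕ) : ZMod r) - i ∈ S) :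
    ∃ γ : F, IsPrimitiveRoot γ (2 ^ (2 * h + 1) - 1) ∧ ∀ a, 1 ≤ a → a ≤ 2 ^ h →
      ∃ j ∈ weightSet r (2 * h + 1) S, γ ^ a = α ^ j := by
  obtain ⟨q, hq⟩ : ∃ q, 2 ^ h = q + 2 := ⟨2 ^ h - 2, by
    have := Nat.pow_le_pow_right (n := 2) (by norm_num) hh
    omega⟩
  have hpow : 2 ^ (2 * h + 1) = 2 * (2 ^ h * 2 ^ h) := by rw [pow_succ', two_mul h, pow_add]
  -- Modulo `2 ^ h - 1` the length is `1`, so `α ^ (2 ^ h - 1)` is again a primitive root.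
  have hcop : Nat.Coprime (2 ^ h - 1) (2 ^ (2 * h + 1) - 1) := by
    have : 2 ^ (2 * h + 1) - 1 = (2 ^ h - 1) * (2 * (2 ^ h + 1)) + 1 := by
      rw [hpow, hq, show q + 2 - 1 = q + 1 by omega]
      have : 2 * ((q + 2) * (q + 2)) = (q + 1) * (2 * (q + 2 + 1)) + 1 + 1 := by ring
      omega
    rw [this]
    simp
  have hγ := hα.pow_of_coprime _ hcop
  have hlt : ∀ a, a ≤ 2 ^ h → a * (2 ^ h - 1) < 2 ^ (2 * h + 1) - 1 := by
    intro a ha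
    have h1 : a * (2 ^ h - 1) ≤ 2 ^ h * (2 ^ h - 1) := Nat.mul_le_mul_right _ ha
    refine h1.trans_lt ?_
    rw [hpow, hq, show q + 2 - 1 = q + 1 by omega]
    have : 2 * ((q + 2) * (q + 2)) = (q + 2) * (q + 1) + ((q + 2) * (q + 3)) := by ring
    have : 2 ≤ (q + 2) * (q + 3) := by nlinarith
    omega
  have hpos : ∀ a, 1 ≤ a → 0 < a * (2 ^ h - 1) := fun a ha => Nat.mul_pos ha (by omega)
  by_cases hmem : (h : ZMod r) ∈ S
  · refine ⟨_, hγ, fun a ha ha' => ⟨a * (2 ^ h - 1), ?_, ?_⟩⟩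
    · rw [mem_weightSet_iff (hpos a ha) (hlt a ha'), binaryWeight_mul_two_pow_sub_one h a ha ha']
      exact hmem
    · rw [← pow_mul, mul_comm]
  -- Here `h ∉ S`, hence `h + 1 = m - h ∈ S`. Inverting the root replaces the exponents by their
  -- complements, of weight `h + 1`.
  · refine ⟨_, hγ.inv, fun a ha ha' => ⟨2 ^ (2 * h + 1) - 1 - a * (2 ^ h - 1), ?_, ?_⟩⟩
    · rw [← mem_weightSet_compl_iff hS (hpos a ha) (hlt a ha'),
        mem_weightSet_iff (hpos a ha) (hlt a ha'), binaryWeight_mul_two_pow_sub_one h a ha ha']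
      exact Finset.mem_compl.2 hmem
    · rw [inv_pow, ← pow_mul, mul_comm]
      refine inv_eq_of_mul_eq_one_right ?_
      rw [← pow_add, Nat.add_sub_cancel' (hlt a ha').le, hα.pow_eq_one]

variable [Algebra (ZMod 2) F]

/-! ### Dimension, dual and extension -/

theorem finrank_weightCode (hα : IsPrimitiveRoot α (2 ^ m - 1)) (hm : 1 ≤ m)
    (hS : ∀ i : ZMod r, i ∈ Sᶜ ↔ (m : ZMod r) - i ∈ S) :
    Module.finrank (ZMod 2) (weightCode r m S α) = 2 ^ (m - 1) := by
  rw [weightCode, finrank_cyclic_of_map (map_weightPoly r m S α hα.pow_eq_one),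
    card_weightSet hm hS]
  have h3 : 2 ^ m = 2 * 2 ^ (m - 1) := by
    rw [← pow_succ', Nat.sub_add_cancel hm]
  have := Nat.one_le_two_pow (n := m - 1)
  omega

theorem finrank_dual_weightCode (hα : IsPrimitiveRoot α (2 ^ m - 1)) (hm : 1 ≤ m)
    (hS : ∀ i : ZMod r, i ∈ Sᶜ ↔ (m : ZMod r) - i ∈ S) :
    Module.finrank (ZMod 2) (weightCode r m S α).dual = 2 ^ (m - 1) - 1 := by
  rw [finrank_dual, finrank_weightCode hα hm hS]
  have h3 : 2 ^ m = 2 * 2 ^ (m - 1) := by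
    rw [← pow_succ', Nat.sub_add_cancel hm]
  omega

theorem sum_mul_of_mem_weightCode (hα : IsPrimitiveRoot α (2 ^ m - 1)) (hm : 1 ≤ m)
    (hS : ∀ i : ZMod r, i ∈ Sᶜ ↔ (m : ZMod r) - i ∈ S) {c e : Fin (2 ^ m - 1) → ZMod 2}
    (hc : c ∈ weightCode r m S α) (he : e ∈ weightCode r m S α) :
    ∑ i, c i * e i = (∑ i, c i) * ∑ i, e i := by
  rw [mem_weightCode_iff hα] at hc he
  have hodd : Odd (2 ^ m - 1) :=
    Nat.Even.sub_odd Nat.one_le_two_pow (Nat.even_pow.2 ⟨even_two, by omega⟩) odd_one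
  refine sum_mul_eq_sum_mul_sum hα hodd fun j h0 hj => ?_
  rcases mem_or_mem_weightSet_compl (S := S) h0 hj with h | h
  · exact Or.inl (hc j h)
  · exact Or.inr (he _ ((mem_weightSet_compl_iff hS h0 hj).1 h))

/-- The extra zero `1` makes the coordinate sum vanish, so the inner product formula makes this
subcode orthogonal to the code; the dimensions agree. -/
theorem dual_weightCode (hα : IsPrimitiveRoot α (2 ^ m - 1)) (hm : 1 ≤ m)
    (hS : ∀ i : ZMod r, i ∈ Sᶜ ↔ (m : ZMod r) - i ∈ S) :
    (weightCode r m S α).dual = cyclic (2 ^ m - 1) ((X - 1) * weightPoly r m S α) := by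
  refine (Submodule.eq_of_le_of_finrank_eq (fun x hx c hc => ?_) ?_).symm
  · have hx1 : x ∈ weightCode r m S α := (dvd_mul_left _ _).trans hx
    have hx0 : X - C 1 ∣ wordPoly x := by
      rw [map_one]
      exact (dvd_mul_right _ _).trans hx
    rw [sum_mul_of_mem_weightCode hα hm hS hx1 hc]
    have h := (dvd_iff_isRoot.1 hx0).eq_zero
    simp only [wordPoly, eval_finsetSum, eval_mul, eval_C, eval_pow, eval_X, one_pow, mul_one] at h
    rw [h, zero_mul]
  · rw [finrank_cyclic_of_map (map_X_sub_one_mul_weightPoly hα),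
      finrank_dual_weightCode hα hm hS, Finset.card_insert_of_notMem zero_notMem_weightSet,
      card_weightSet hm hS]
    have h3 : 2 ^ m = 2 * 2 ^ (m - 1) := by
      rw [← pow_succ', Nat.sub_add_cancel hm]
    have := Nat.one_le_two_pow (n := m - 1)
    omega

theorem isSelfDual_extended_weightCode (hα : IsPrimitiveRoot α (2 ^ m - 1)) (hm : 1 ≤ m)
    (hS : ∀ i : ZMod r, i ∈ Sᶜ ↔ (m : ZMod r) - i ∈ S) :
    (weightCode r m S α).extended.IsSelfDual := by
  refine isSelfDual_extended (fun c hc e he => sum_mul_of_mem_weightCode hα hm hS hc he) ?_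
  rw [finrank_weightCode hα hm hS, ← pow_succ', Nat.sub_add_cancel hm,
    Nat.sub_add_cancel Nat.one_le_two_pow]

theorem isDoublyEven_extended_weightCode (hα : IsPrimitiveRoot α (2 ^ m - 1)) (hm : 3 ≤ m)
    (hS : ∀ i : ZMod r, i ∈ Sᶜ ↔ (m : ZMod r) - i ∈ S) :
    (weightCode r m S α).extended.IsDoublyEven := by
  intro x hx
  have h4 := two_pow_sub_one_mod_four hm
  have : NeZero (2 ^ m - 1) := ⟨by omega⟩
  rw [hammingNorm_extended hx]
  have hc := (mem_extended_iff.1 hx).1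
  generalize (fun i : Fin (2 ^ m - 1) => x i.castSucc) = c at hc
  refine four_dvd_hammingNorm_add h4 c fun k => ?_
  have hk : (fun i => c (i + k)) ∈ weightCode r m S α := by
    rw [mem_weightCode_iff hα] at hc ⊢
    intro j hj
    have hαj : (α ^ j) ^ (2 ^ m - 1) = 1 := by
      rw [← pow_mul, mul_comm, pow_mul, hα.pow_eq_one, one_pow]
    have h := aeval_wordPoly_shift c k hαj
    rw [hc j hj] at h
    refine (mul_eq_zero.1 h).resolve_right (pow_ne_zero _ (pow_ne_zero _ ?_))
    exact hα.ne_zero (NeZero.ne _)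
  have hshift : ∑ i, c (i + k) = ∑ i, c i := Equiv.sum_comp (Equiv.addRight k) c
  rw [sum_mul_of_mem_weightCode hα (by omega) hS hc hk, hshift]
  generalize ∑ i, c i = a
  revert a
  decide

/-! ### Minimum distance -/

/-- The weight bound is kept next to the parameters because the extended code needs it word by word.
-/
theorem hasParameters_weightCode (hα : IsPrimitiveRoot α (2 ^ m - 1)) (hm : Odd m) (hm3 : 3 ≤ m)
    (hS : ∀ i : ZMod r, i ∈ Sᶜ ↔ (m : ZMod r) - i ∈ S) :
    (∀ c ∈ weightCode r m S α, c ≠ 0 → 2 ^ ((m - 1) / 2) + 1 ≤ hammingNorm c) ∧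
      (weightCode r m S α).HasParameters (2 ^ m - 1) (2 ^ (m - 1)) (2 ^ ((m - 1) / 2) + 1) := by
  have hdist : ∀ c ∈ weightCode r m S α, c ≠ 0 → 2 ^ ((m - 1) / 2) + 1 ≤ hammingNorm c := by
    obtain ⟨h, rfl⟩ := hm
    obtain ⟨γ, hγ, hz⟩ := exists_consecutive_zeros hα (by omega) hS
    intro c hc hc0
    rw [show (2 * h + 1 - 1) / 2 = h by omega]
    refine lt_hammingNorm_of_consecutive_zeros hγ 1 (2 ^ h) hc0 fun a ha => ?_
    obtain ⟨j, hj, e⟩ := hz (1 + a) (by omega) (by omega)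
    rw [e]
    exact (mem_weightCode_iff hα).1 hc j hj
  have hfin := finrank_weightCode hα (by omega) hS
  have hne : weightCode r m S α ≠ ⊥ := by
    intro e
    rw [e, finrank_bot] at hfin
    exact (pow_pos two_pos _).ne hfin
  exact ⟨hdist, rfl, hfin, hne, le_minDist hne hdist⟩

theorem hasParameters_dual_weightCode (hα : IsPrimitiveRoot α (2 ^ m - 1)) (hm : Odd m)
    (hm3 : 3 ≤ m) (hS : ∀ i : ZMod r, i ∈ Sᶜ ↔ (m : ZMod r) - i ∈ S) :
    (weightCode r m S α).dual.HasParameters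
      (2 ^ m - 1) (2 ^ (m - 1) - 1) (2 ^ ((m - 1) / 2) + 2) := by
  have hfin := finrank_dual_weightCode hα (by omega) hS
  have hne : (weightCode r m S α).dual ≠ ⊥ := by
    intro e
    rw [e, finrank_bot] at hfin
    have := Nat.pow_le_pow_right (n := 2) (by norm_num) (show 1 ≤ m - 1 by omega)
    omega
  refine ⟨rfl, hfin, hne, le_minDist hne fun c hc hc0 => ?_⟩
  rw [dual_weightCode hα (by omega) hS] at hc
  have hzero : ∀ j ∈ insert 0 (weightSet r m S), aeval (α ^ j) (wordPoly c) = 0 := by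
    refine (dvd_iff_aeval_eq_zero hα (fun j hj => ?_) (map_X_sub_one_mul_weightPoly hα) _).1 hc
    rcases Finset.mem_insert.1 hj with rfl | hj
    · have := two_pow_sub_one_mod_four hm3
      omega
    · exact lt_of_mem_weightSet hj
  obtain ⟨h, rfl⟩ := hm
  obtain ⟨γ, hγ, hz⟩ := exists_consecutive_zeros hα (by omega) hS
  rw [show (2 * h + 1 - 1) / 2 = h by omega]
  -- The run now starts at `γ ^ 0 = 1`, so it is one longer than for the code itself.
  refine lt_hammingNorm_of_consecutive_zeros hγ 0 (2 ^ h + 1) hc0 fun a ha => ?_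
  rw [zero_add]
  rcases Nat.eq_zero_or_pos a with rfl | ha0
  · rw [pow_zero, ← pow_zero α]
    exact hzero 0 (Finset.mem_insert_self _ _)
  · obtain ⟨j, hj, e⟩ := hz a ha0 (by omega)
    rw [e]
    exact hzero j (Finset.mem_insert_of_mem hj)

theorem hasParameters_extended_weightCode (hα : IsPrimitiveRoot α (2 ^ m - 1)) (hm : Odd m)
    (hm3 : 3 ≤ m) (hS : ∀ i : ZMod r, i ∈ Sᶜ ↔ (m : ZMod r) - i ∈ S) :
    (weightCode r m S α).extended.HasParameters
      (2 ^ m) (2 ^ (m - 1)) (2 ^ ((m - 1) / 2) + if m = 3 then 2 else 4) := by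
  have hfin : Module.finrank (ZMod 2) (weightCode r m S α).extended = 2 ^ (m - 1) := by
    rw [finrank_extended, finrank_weightCode hα (by omega) hS]
  have hne : (weightCode r m S α).extended ≠ ⊥ := by
    intro e
    rw [e, finrank_bot] at hfin
    exact (pow_pos two_pos _).ne hfin
  refine ⟨Nat.sub_add_cancel Nat.one_le_two_pow, hfin, hne, le_minDist hne fun x hx hx0 => ?_⟩
  obtain ⟨q, hq⟩ := isDoublyEven_extended_weightCode hα hm3 hS x hx
  have hx' := mem_extended_iff.1 hx
  have hc0 : (fun i : Fin (2 ^ m - 1) => x i.castSucc) ≠ 0 := by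
    intro e
    refine hx0 (funext fun i => ?_)
    refine Fin.lastCases ?_ (fun i => congrFun e i) i
    refine hx'.2.trans (Finset.sum_eq_zero fun i _ => congrFun e i)
  have hw := (hasParameters_weightCode hα hm hm3 hS).1 _ hx'.1 hc0
  have hle := hammingNorm_extended hx
  -- The weight of `x` is a multiple of four above `2 ^ h`. For `m = 3` it is at least `3`, hence at
  -- least `4`; for `h ≥ 2`, `2 ^ h` is itself a multiple of four, and the next one is `2 ^ h + 4`.
  split_ifs with h3
  · subst h3
    norm_num at hw ⊢
    omega
  · obtain ⟨h, rfl⟩ := hm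
    rw [show (2 * h + 1 - 1) / 2 = h by omega] at hw ⊢
    obtain ⟨k, rfl⟩ : ∃ k, h = k + 2 := ⟨h - 2, by omega⟩
    rw [pow_add] at hw ⊢
    omega

/-! ### Splittings -/

theorem isSplitting_weightSet (hm3 : 3 ≤ m) (hS : ∀ i : ZMod r, i ∈ Sᶜ ↔ (m : ZMod r) - i ∈ S) :
    IsSplitting {i : ZMod (2 ^ m - 1) | i.val ∈ weightSet r m S}
      {i : ZMod (2 ^ m - 1) | i.val ∈ weightSet r m Sᶜ} (-1) := by
  have h4 := two_pow_sub_one_mod_four hm3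
  have hn : 2 < 2 ^ m - 1 := by omega
  have : NeZero (2 ^ m - 1) := ⟨by omega⟩
  have hneg : ∀ s : ZMod (2 ^ m - 1),
      (-s).val ∈ weightSet r m S ↔ s.val ∈ weightSet r m Sᶜ := by
    intro s
    rcases eq_or_ne s 0 with rfl | hs
    · simp [zero_notMem_weightSet]
    · have hpos : 0 < s.val := Nat.pos_of_ne_zero ((ZMod.val_ne_zero s).2 hs)
      rw [mem_weightSet_compl_iff hS hpos s.val_lt, ZMod.neg_val, if_neg hs]
  refine ⟨fun s hs => cyclotomicCoset_subset hn hs, fun s hs => cyclotomicCoset_subset hn hs,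
    ?_, ?_, ?_, ?_⟩
  · ext s
    rw [Set.mem_compl_singleton_iff]
    constructor
    · rintro (h | h) rfl <;> exact zero_notMem_weightSet (by simpa using h)
    · intro hs
      exact mem_or_mem_weightSet_compl (Nat.pos_of_ne_zero ((ZMod.val_ne_zero s).2 hs)) s.val_lt
  · ext s
    simp only [Set.mem_inter_iff, Set.mem_ofPred_eq, Set.mem_empty_iff_false, iff_false, not_and]
    intro h1 h2
    exact Finset.mem_compl.1 (Finset.mem_filter.1 h2).2 (Finset.mem_filter.1 h1).2
  · ext s
    simp only [Units.val_neg, Units.val_one, mul_neg, mul_one, Set.mem_image, Set.mem_ofPred_eq]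
    rw [← hneg]
    constructor
    · rintro ⟨x, hx, rfl⟩
      rwa [neg_neg]
    · intro h
      exact ⟨-s, h, neg_neg s⟩
  · ext s
    simp only [Units.val_neg, Units.val_one, mul_neg, mul_one, Set.mem_image, Set.mem_ofPred_eq]
    constructor
    · rintro ⟨x, hx, rfl⟩
      rwa [hneg]
    · intro h
      refine ⟨-s, ?_, neg_neg s⟩
      rwa [← hneg, neg_neg]

theorem hasDefiningSet_dual_weightCode (hα : IsPrimitiveRoot α (2 ^ m - 1)) (hm3 : 3 ≤ m)
    (hS : ∀ i : ZMod r, i ∈ Sᶜ ↔ (m : ZMod r) - i ∈ S) :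
    HasDefiningSet α (weightCode r m S α).dual
      ({0} ∪ {i : ZMod (2 ^ m - 1) | i.val ∈ weightSet r m S}) := by
  have h4 := two_pow_sub_one_mod_four hm3
  have : NeZero (2 ^ m - 1) := ⟨by omega⟩
  have hlt : ∀ j ∈ insert 0 (weightSet r m S), j < 2 ^ m - 1 := by
    intro j hj
    rcases Finset.mem_insert.1 hj with rfl | hj
    · omega
    · exact lt_of_mem_weightSet hj
  rw [dual_weightCode hα (by omega) hS]
  convert hasDefiningSet_cyclic hα hlt (map_X_sub_one_mul_weightPoly hα) using 1
  ext i
  simp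

end WeightCode

end BinaryCode

theorem theorem7 {F : Type*} [Field F] [Fintype F] [Algebra (ZMod 2) F]
    (r m : ℕ) [NeZero r] (hr : Even r) (hm : Odd m) (hm3 : 3 ≤ m)
    (hF : Fintype.card F = 2 ^ m) (α : F) (hα : IsPrimitiveRoot α (2 ^ m - 1))
    (t : ℤ) (ht : Odd t) (ht1 : t ≠ 1) (hmt : (m : ℤ) ≡ t [ZMOD r])
    (S : Finset (ZMod r)) (hcard : S.card = r / 2)
    (hS : ∀ i : ZMod r, i ∈ Sᶜ ↔ (t : ZMod r) - i ∈ S)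
    (hmem :
      ((((t - 1) / 2 : ℤ) : ZMod r) ∈ S ∧ (((t + r - 1) / 2 : ℤ) : ZMod r) ∈ S ∧ 1 ∈ S) ∨
      ((((t + 1) / 2 : ℤ) : ZMod r) ∈ S ∧ (((t + r + 1) / 2 : ℤ) : ZMod r) ∈ S ∧
        ((t - 1 : ℤ) : ZMod r) ∈ S)) :
    (BinaryCode.IsOddLikeDuadicPair α
        (BinaryCode.weightCode r m S α) (BinaryCode.weightCode r m Sᶜ α) ∧
      ∀ R ∈ ({S, Sᶜ} : Set (Finset (ZMod r))), (BinaryCode.weightCode r m R α).HasParameters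
        (2 ^ m - 1) (2 ^ (m - 1)) (2 ^ ((m - 1) / 2) + 1)) ∧
    (BinaryCode.IsEvenLikeDuadicPair α
        (BinaryCode.weightCode r m S α).dual (BinaryCode.weightCode r m Sᶜ α).dual ∧
      ∀ R ∈ ({S, Sᶜ} : Set (Finset (ZMod r))), (BinaryCode.weightCode r m R α).dual.HasParameters
        (2 ^ m - 1) (2 ^ (m - 1) - 1) (2 ^ ((m - 1) / 2) + 2)) ∧
    (∀ R ∈ ({S, Sᶜ} : Set (Finset (ZMod r))),
      (BinaryCode.weightCode r m R α).extended.HasParameters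
        (2 ^ m) (2 ^ (m - 1)) (2 ^ ((m - 1) / 2) + if m = 3 then 2 else 4) ∧
      (BinaryCode.weightCode r m R α).extended.IsSelfDual ∧
      (BinaryCode.weightCode r m R α).extended.IsDoublyEven) := by
  have hmt' : (t : ZMod r) = (m : ZMod r) := by
    have h := (ZMod.intCast_eq_intCast_iff _ _ r).2 hmt
    rw [← h, Int.cast_natCast]
  rw [hmt'] at hS
  -- The reflection `i ↦ m - i` is an involution, so every result for `S` also applies to `Sᶜ`.
  have hS' : ∀ i : ZMod r, i ∈ Sᶜᶜ ↔ (m : ZMod r) - i ∈ Sᶜ := by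
    intro i
    rw [hS, sub_sub_cancel, compl_compl]
  have hsplit := BinaryCode.isSplitting_weightSet hm3 hS
  refine ⟨⟨⟨_, _, _, hsplit, BinaryCode.hasDefiningSet_weightCode hα hm3,
      BinaryCode.hasDefiningSet_weightCode hα hm3⟩, ?_⟩,
    ⟨⟨_, _, _, hsplit, BinaryCode.hasDefiningSet_dual_weightCode hα hm3 hS,
      BinaryCode.hasDefiningSet_dual_weightCode hα hm3 hS'⟩, ?_⟩, ?_⟩
  · rintro R (rfl | rfl)
    · exact (BinaryCode.hasParameters_weightCode hα hm hm3 hS).2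
    · exact (BinaryCode.hasParameters_weightCode hα hm hm3 hS').2
  · rintro R (rfl | rfl)
    · exact BinaryCode.hasParameters_dual_weightCode hα hm hm3 hS
    · exact BinaryCode.hasParameters_dual_weightCode hα hm hm3 hS'
  · rintro R (rfl | rfl)
    · exact ⟨BinaryCode.hasParameters_extended_weightCode hα hm hm3 hS,
        BinaryCode.isSelfDual_extended_weightCode hα (by omega) hS,
        BinaryCode.isDoublyEven_extended_weightCode hα hm3 hS⟩
    · exact ⟨BinaryCode.hasParameters_extended_weightCode hα hm hm3 hS',
        BinaryCode.isSelfDual_extended_weightCode hα (by omega) hS',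
        BinaryCode.isDoublyEven_extended_weightCode hα hm3 hS'⟩
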